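/- Let $X$ be a real Banach space. A modulus of continuity is a continuous function $\omega:[0,\infty)\to[0,\infty)$ with $\omega(0)=0$. For $L\in(0,1]$, a self-map $T$ of a set $K\subseteq X$ is called $L$-$\omega$-nonexpansive if $$\|Tx-Ty\|\le L\|x-y\|+\omega(\|x-y\|)\qquad\text{for all }x,y\in K .$$ The set $K$ has the approximate fixed point property (AFPP) for a class of self-maps of $K$ if every map $T$ in the class satisfies $\inf_{x\in K}\|x-Tx\|=0$. Let $C\subseteq X$ be a bounded, closed, noncompact convex set, and let $\omega$ be a modulus of continuity with $\lim_{\delta\to0^+}\omega(\delta)/\delta=\infty$. Then $C$ contains a closed convex subset $K$ such that, for every $L\in(0,1]$, the set $K$ fails the AFPP for $L$-$\omega$-nonexpansive maps; that is, for every $L\in(0,1]$ there is an $L$-$\omega$-nonexpansive map $T:K\to K$ with $\inf_{x\in K}\|x-Tx\|>0$. Moreover, $K$ can be taken to be an arbitrarily small homothetic copy of $C$: for every $\varepsilon>0$ there is such a $K$ of the form $K=\{x_0+\eta(x-x_0): x\in C\}$ with $x_0\in C$ and $0<\eta<\min(1,\varepsilon)$. -/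

import Mathlib

open Filter Topology
open scoped NNReal

/-- A modulus of continuity: a continuous function `ω : [0,∞) → [0,∞)` with `ω 0 = 0`. -/
structure IsModulus (ω : ℝ≥0 → ℝ≥0) : Prop where
  continuous : Continuous ω
  map_zero : ω 0 = 0

/-- The condition `ω(δ) / δ → ∞` as `δ → 0⁺`. -/
def InfiniteSlopeAtZero (ω : ℝ≥0 → ℝ≥0) : Prop :=
  Tendsto (fun δ : ℝ≥0 => ω δ / δ) (𝓝[>] 0) atTop

/-- `T` is `L`-`ω`-nonexpansive: `ρ(Tx, Ty) ≤ L ρ(x, y) + ω(ρ(x, y))` for all `x, y`. -/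
def IsNonexpansiveWith {M : Type*} [MetricSpace M] (L : ℝ) (ω : ℝ≥0 → ℝ≥0) (T : M → M) : Prop :=
  ∀ x y : M, dist (T x) (T y) ≤ L * dist x y + ω (nndist x y)

/-- The minimal displacement `inf_x ρ(x, Tx)` of a self-map `T`. -/
noncomputable def minimalDisplacement {M : Type*} [MetricSpace M] (T : M → M) : ℝ :=
  ⨅ x : M, dist x (T x)

/-- `M` has the approximate fixed point property for a class `F` of self-maps of `M`. -/
def HasAFPP (M : Type*) [MetricSpace M] (F : Set (M → M)) : Prop :=
  ∀ T ∈ F, minimalDisplacement T = 0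

/-!
Any bounded convex set `C` that is not totally bounded carries a Lipschitz self-map `T` with
`‖x - T x‖ ≥ d > 0` (`exists_lipschitz_displacement`). Conjugating `T` by a homothety of ratio `η`
keeps its Lipschitz constant `Λ` and multiplies the displacement by `η`. Since `ω(δ) / δ → ∞`, on a
copy of `C` of sufficiently small diameter `Λ ‖x - y‖ ≤ ω(‖x - y‖)`, so there the conjugated map is
`L`-`ω`-nonexpansive for every `L`.

The map `T` factors through a model space. The fan `IsFan` consists of the sequences with values in
`[0, 12]` supported on two neighbouring indices; it is a bounded cone over a half-line. It is useful
for two reasons.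

* It is a Lipschitz retract of all sequences with values in `[0, 12]`, by the formula
  `f ↦ (fₙ - sup_{|m - n| ≥ 2} fₘ)⁺` (`focus`). A set that is not totally bounded contains points
  `z + yₙ` with `yₙ` uniformly far from the span of its predecessors, so the fan embeds in `C` by
  `p ↦ z + (1 / 24) ∑ pₙ yₙ`, and this embedding is bi-Lipschitz because differences of fan elements
  have at most four nonzero coordinates. The coordinates extend to Lipschitz functions on the whole
  space; together with `focus` they retract the space onto the embedded fan.
* It has a Lipschitz self-map `push` without approximate fixed points (`exists_lt_abs_push_sub`).
  With `t = sup f` the height, `push` is the forward shift for `t ≥ 4`; as `t` decreases to `3` it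
  turns to an upward motion `f ↦ 2 f`, as `t` decreases to `2` it turns to the (doubled) backward
  shift, and below `1` a multiple of the first unit vector is added, so that the apex `0` moves too.
  The detour from the forward shift through the upward motion to the backward shift is what makes
  the winding number of the displacement vanish: a direct passage from the forward shift to the
  apex would create a fixed point.
-/

/-! ### Nonnegative sequences supported on two neighbouring indices -/

/-- Sequences with values in `[0, 12]` whose support is contained in a pair `{n, n + 1}`: a union of
squares glued along edges, a cone over a half-line. The bound `12` is the one that makes the set
invariant under `push`. -/
structure IsFan (f : ℕ → ℝ) : Prop where
  nonneg : ∀ n, 0 ≤ f n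
  le : ∀ n, f n ≤ 12
  near : ∀ n m, 0 < f n → 0 < f m → m ≤ n + 1

/-- The supremum of `f` over the indices at distance at least two from `n`; the remaining indices
contribute `0`, which is harmless for nonnegative `f`. -/
noncomputable def farSup (f : ℕ → ℝ) (n : ℕ) : ℝ :=
  ⨆ m : ℕ, if n ≤ m + 1 ∧ m ≤ n + 1 then 0 else f m

/-- The retraction `f ↦ (fₙ - sup_{|m - n| ≥ 2} fₘ)⁺` of the sequences with values in `[0, 12]` onto
the fan. -/
noncomputable def focus (f : ℕ → ℝ) (n : ℕ) : ℝ := max 0 (f n - farSup f n)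

theorem abs_iSup_sub_iSup_le {f g : ℕ → ℝ} (hf : BddAbove (Set.range f))
    (hg : BddAbove (Set.range g)) {δ : ℝ} (h : ∀ n, |f n - g n| ≤ δ) :
    |(⨆ n, f n) - ⨆ n, g n| ≤ δ := by
  rw [abs_sub_le_iff]
  constructor
  · rw [sub_le_iff_le_add]
    refine ciSup_le fun n => ?_
    have := le_ciSup hg n
    have := (abs_le.1 (h n)).2
    linarith
  · rw [sub_le_iff_le_add]
    refine ciSup_le fun n => ?_
    have := le_ciSup hf n
    have := (abs_le.1 (h n)).1
    linarith

theorem bddAbove_range_of_le {f : ℕ → ℝ} {K : ℝ} (h : ∀ n, f n ≤ K) : BddAbove (Set.range f) :=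
  ⟨K, by rintro _ ⟨n, rfl⟩; exact h n⟩

theorem farSup_term_le {f : ℕ → ℝ} (hle : ∀ n, f n ≤ 12) (n m : ℕ) :
    (if n ≤ m + 1 ∧ m ≤ n + 1 then 0 else f m) ≤ 12 := by
  split_ifs
  · norm_num
  · exact hle m

theorem le_farSup {f : ℕ → ℝ} (hle : ∀ n, f n ≤ 12) {n m : ℕ} (h : ¬ (n ≤ m + 1 ∧ m ≤ n + 1)) :
    f m ≤ farSup f n := by
  have := le_ciSup (bddAbove_range_of_le (farSup_term_le hle n)) m
  simpa [farSup, h] using this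

theorem farSup_nonneg {f : ℕ → ℝ} (hle : ∀ n, f n ≤ 12) (n : ℕ) : 0 ≤ farSup f n := by
  have := le_ciSup (bddAbove_range_of_le (farSup_term_le hle n)) n
  simpa [farSup] using this

theorem farSup_le {f : ℕ → ℝ} {n : ℕ} {b : ℝ} (hb : 0 ≤ b)
    (h : ∀ m, ¬ (n ≤ m + 1 ∧ m ≤ n + 1) → f m ≤ b) : farSup f n ≤ b := by
  refine ciSup_le fun m => ?_
  split_ifs with hm
  · exact hb
  · exact h m hm

theorem abs_focus_sub_focus_le {f g : ℕ → ℝ} (hf : ∀ n, f n ≤ 12) (hg : ∀ n, g n ≤ 12) {δ : ℝ}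
    (hδ : 0 ≤ δ) (h : ∀ n, |f n - g n| ≤ δ) (n : ℕ) : |focus f n - focus g n| ≤ 2 * δ := by
  have h1 : |farSup f n - farSup g n| ≤ δ := by
    refine abs_iSup_sub_iSup_le (bddAbove_range_of_le (farSup_term_le hf n))
      (bddAbove_range_of_le (farSup_term_le hg n)) fun m => ?_
    split_ifs
    · simpa using hδ
    · exact h m
  refine (abs_max_sub_max_le_max 0 (f n - farSup f n) 0 (g n - farSup g n)).trans ?_
  refine max_le (by simpa using hδ) ?_
  have h2 := abs_le.1 h1
  have h3 := abs_le.1 (h n)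
  rw [abs_le]
  constructor <;> linarith

theorem isFan_focus {f : ℕ → ℝ} (hle : ∀ n, f n ≤ 12) : IsFan (focus f) where
  nonneg n := le_max_left _ _
  le n := max_le (by norm_num) (by linarith [hle n, farSup_nonneg hle n])
  near n m hn hm := by
    by_contra hcon
    have h1 : f m ≤ farSup f n := le_farSup hle (by omega)
    have h2 : f n ≤ farSup f m := le_farSup hle (by omega)
    have hn' := (lt_max_iff.1 hn).resolve_left (lt_irrefl _)
    have hm' := (lt_max_iff.1 hm).resolve_left (lt_irrefl _)
    linarith

namespace IsFan

variable {f : ℕ → ℝ}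

theorem focus_eq (hf : IsFan f) : focus f = f := by
  funext n
  rcases (hf.nonneg n).eq_or_lt with h0 | h0
  · rw [focus, ← h0, max_eq_left]
    linarith [farSup_nonneg hf.le n]
  · have : farSup f n = 0 := by
      refine le_antisymm (farSup_le le_rfl fun m hm => ?_) (farSup_nonneg hf.le n)
      by_contra! hm0
      have := hf.near n m h0 hm0
      have := hf.near m n hm0 h0
      omega
    rw [focus, this, sub_zero, max_eq_right h0.le]

theorem exists_support (hf : IsFan f) : ∃ N, ∀ m, m ≠ N → m ≠ N + 1 → f m = 0 := by
  classical
  by_cases h : ∃ n, 0 < f n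
  · refine ⟨Nat.find h, fun m hm hm' => ?_⟩
    by_contra h0
    have hpos : 0 < f m := lt_of_le_of_ne (hf.nonneg m) (Ne.symm h0)
    have h1 := hf.near _ m (Nat.find_spec h) hpos
    have h2 := Nat.find_min' h hpos
    omega
  · push Not at h
    exact ⟨0, fun m _ _ => le_antisymm (h m) (hf.nonneg m)⟩

theorem le_iSup (hf : IsFan f) (n : ℕ) : f n ≤ ⨆ k, f k :=
  le_ciSup (bddAbove_range_of_le hf.le) n

theorem iSup_le (hf : IsFan f) : ⨆ k, f k ≤ 12 := ciSup_le hf.le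

theorem iSup_nonneg (hf : IsFan f) : 0 ≤ ⨆ k, f k := (hf.nonneg 0).trans (hf.le_iSup 0)

theorem iSup_eq (hf : IsFan f) {N : ℕ} (h : ∀ m, m ≠ N → m ≠ N + 1 → f m = 0) :
    ⨆ k, f k = max (f N) (f (N + 1)) := by
  refine le_antisymm (ciSup_le fun m => ?_) (max_le (hf.le_iSup _) (hf.le_iSup _))
  by_cases h1 : m = N
  · subst h1; exact le_max_left _ _
  by_cases h2 : m = N + 1
  · subst h2; exact le_max_right _ _
  rw [h m h1 h2]
  exact (hf.nonneg N).trans (le_max_left _ _)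

end IsFan

/-! ### A Lipschitz self-map of the fan without approximate fixed points -/

/-- Weight of the forward shift, as a function of the height `t = sup f`. -/
noncomputable def wFwd (t : ℝ) : ℝ := max 0 (min 1 (t - 3))

/-- Weight of the identity, as a function of the height. -/
noncomputable def wStay (t : ℝ) : ℝ := max 0 (2 - 2 * |t - 3|)

/-- Weight of the backward shift, as a function of the height. -/
noncomputable def wBack (t : ℝ) : ℝ := 2 * max 0 (min 1 (3 - t))

/-- Weight of the first unit vector, as a function of the height. -/
noncomputable def wTop (t : ℝ) : ℝ := max 0 (1 - t)

/-- The linear combination of the forward shift, the identity, the backward shift (which sends the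
first unit vector to itself) and the first unit vector, with weights depending on the height. -/
noncomputable def mix (f : ℕ → ℝ) : ℕ → ℝ
  | 0 => (wStay (⨆ k, f k) + wBack (⨆ k, f k)) * f 0 + wBack (⨆ k, f k) * f 1 + wTop (⨆ k, f k)
  | n + 1 => wFwd (⨆ k, f k) * f n + wStay (⨆ k, f k) * f (n + 1) + wBack (⨆ k, f k) * f (n + 2)

theorem wFwd_lip (s t : ℝ) : |wFwd s - wFwd t| ≤ |s - t| := by
  simp only [wFwd, max_def, min_def, abs_le]
  rcases abs_cases (s - t) with ⟨h, _⟩ | ⟨h, _⟩ <;> rw [h] <;> split_ifs <;> constructor <;> linarith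

theorem wBack_lip (s t : ℝ) : |wBack s - wBack t| ≤ 2 * |s - t| := by
  simp only [wBack, max_def, min_def, abs_le]
  rcases abs_cases (s - t) with ⟨h, _⟩ | ⟨h, _⟩ <;> rw [h] <;> split_ifs <;> constructor <;> linarith

theorem wTop_lip (s t : ℝ) : |wTop s - wTop t| ≤ |s - t| := by
  simp only [wTop, max_def, abs_le]
  rcases abs_cases (s - t) with ⟨h, _⟩ | ⟨h, _⟩ <;> rw [h] <;> split_ifs <;> constructor <;> linarith

theorem wStay_lip (s t : ℝ) : |wStay s - wStay t| ≤ 2 * |s - t| := by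
  refine (abs_max_sub_max_le_max 0 _ 0 _).trans (max_le (by simp) ?_)
  have h1 := abs_abs_sub_abs_le_abs_sub (t - 3) (s - 3)
  have h2 : |t - 3 - (s - 3)| = |s - t| := by rw [abs_sub_comm]; ring_nf
  rw [h2] at h1
  calc |2 - 2 * |s - 3| - (2 - 2 * |t - 3|)| = |2 * (|t - 3| - |s - 3|)| := by ring_nf
    _ = 2 * |(|t - 3| - |s - 3|)| := by rw [abs_mul, abs_two]
    _ ≤ 2 * |s - t| := by linarith

theorem wFwd_bounds (t : ℝ) : 0 ≤ wFwd t ∧ wFwd t ≤ 1 :=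
  ⟨le_max_left _ _, max_le zero_le_one (min_le_left _ _)⟩

theorem wBack_bounds (t : ℝ) : 0 ≤ wBack t ∧ wBack t ≤ 2 := by
  have h1 : max 0 (min 1 (3 - t)) ≤ 1 := max_le zero_le_one (min_le_left _ _)
  have h0 : 0 ≤ max 0 (min 1 (3 - t)) := le_max_left _ _
  constructor <;> unfold wBack <;> linarith

theorem wStay_bounds (t : ℝ) : 0 ≤ wStay t ∧ wStay t ≤ 2 :=
  ⟨le_max_left _ _, max_le zero_le_two (by linarith [abs_nonneg (t - 3)])⟩

theorem weights_of_le_two {t : ℝ} (h : t ≤ 2) :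
    wFwd t = 0 ∧ wStay t = 0 ∧ wBack t = 2 := by
  refine ⟨?_, ?_, ?_⟩
  · rw [wFwd, min_eq_right (by linarith), max_eq_left (by linarith)]
  · rw [wStay, abs_of_nonpos (by linarith), max_eq_left (by linarith)]
  · rw [wBack, min_eq_left (by linarith), max_eq_right (by linarith)]; norm_num

theorem weights_of_mem_two_three {t : ℝ} (h2 : 2 ≤ t) (h3 : t ≤ 3) :
    wFwd t = 0 ∧ wStay t = 2 - wBack t ∧ wTop t = 0 := by
  refine ⟨?_, ?_, ?_⟩
  · rw [wFwd, min_eq_right (by linarith), max_eq_left (by linarith)]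
  · rw [wStay, wBack, abs_of_nonpos (by linarith), max_eq_right (by linarith),
      min_eq_right (by linarith), max_eq_right (by linarith)]
    ring
  · rw [wTop, max_eq_left (by linarith)]

theorem weights_of_three_le {t : ℝ} (h3 : 3 ≤ t) :
    wStay t = 2 - 2 * wFwd t ∧ wBack t = 0 ∧ wTop t = 0 := by
  refine ⟨?_, ?_, ?_⟩
  · rw [wStay, wFwd, abs_of_nonneg (by linarith)]
    rcases le_total t 4 with h | h
    · rw [max_eq_right (by linarith), min_eq_right (by linarith), max_eq_right (by linarith)]
    · rw [max_eq_left (by linarith), min_eq_left (by linarith), max_eq_right (by linarith)]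
      ring
  · rw [wBack, min_eq_right (by linarith), max_eq_left (by linarith), mul_zero]
  · rw [wTop, max_eq_left (by linarith)]

theorem abs_mul_sub_mul_le {w w' p p' A B C δ : ℝ} (hw : |w - w'| ≤ A * δ) (hw0 : 0 ≤ w')
    (hw' : w' ≤ B) (hp0 : 0 ≤ p) (hp : p ≤ C) (hpp : |p - p'| ≤ δ) :
    |w * p - w' * p'| ≤ (A * C + B) * δ := by
  have hδ : 0 ≤ δ := (abs_nonneg _).trans hpp
  calc |w * p - w' * p'| = |(w - w') * p + w' * (p - p')| := by ring_nf
    _ ≤ |(w - w') * p| + |w' * (p - p')| := abs_add_le _ _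
    _ = |w - w'| * p + w' * |p - p'| := by
        rw [abs_mul, abs_mul, abs_of_nonneg hp0, abs_of_nonneg hw0]
    _ ≤ A * δ * C + B * δ := by
        refine add_le_add ?_ (mul_le_mul hw' hpp (abs_nonneg _) (hw0.trans hw'))
        exact mul_le_mul hw hp hp0 ((abs_nonneg _).trans hw)
    _ = (A * C + B) * δ := by ring

theorem abs_mix_sub_mix_le {f g : ℕ → ℝ} (hf : IsFan f) (hg : IsFan g) {δ : ℝ}
    (h : ∀ n, |f n - g n| ≤ δ) (n : ℕ) : |mix f n - mix g n| ≤ 100 * δ := by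
  have hδ : 0 ≤ δ := (abs_nonneg _).trans (h 0)
  have ht := abs_iSup_sub_iSup_le (bddAbove_range_of_le hf.le) (bddAbove_range_of_le hg.le) h
  have hb : ∀ n, |wBack (⨆ k, f k) * f n - wBack (⨆ k, g k) * g n| ≤ (2 * 12 + 2) * δ := fun n =>
    abs_mul_sub_mul_le ((wBack_lip _ _).trans (by linarith)) (wBack_bounds _).1 (wBack_bounds _).2
      (hf.nonneg n) (hf.le n) (h n)
  have hs : ∀ n, |wStay (⨆ k, f k) * f n - wStay (⨆ k, g k) * g n| ≤ (2 * 12 + 2) * δ := fun n =>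
    abs_mul_sub_mul_le ((wStay_lip _ _).trans (by linarith)) (wStay_bounds _).1 (wStay_bounds _).2
      (hf.nonneg n) (hf.le n) (h n)
  have hw : ∀ n, |wFwd (⨆ k, f k) * f n - wFwd (⨆ k, g k) * g n| ≤ (1 * 12 + 1) * δ := fun n =>
    abs_mul_sub_mul_le ((wFwd_lip _ _).trans (by linarith)) (wFwd_bounds _).1 (wFwd_bounds _).2
      (hf.nonneg n) (hf.le n) (h n)
  have hd := (wTop_lip _ _).trans ht
  cases n with
  | zero =>
    have h1 := abs_le.1 (hs 0)
    have h2 := abs_le.1 (hb 0)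
    have h3 := abs_le.1 (hb 1)
    have h4 := abs_le.1 hd
    rw [mix, mix, abs_le]
    constructor <;> nlinarith
  | succ n =>
    have h1 := abs_le.1 (hw n)
    have h2 := abs_le.1 (hs (n + 1))
    have h3 := abs_le.1 (hb (n + 2))
    rw [mix, mix, abs_le]
    constructor <;> linarith

theorem mix_nonneg {f : ℕ → ℝ} (hf : IsFan f) (n : ℕ) : 0 ≤ mix f n := by
  have h1 := (wFwd_bounds (⨆ k, f k)).1
  have h2 := (wStay_bounds (⨆ k, f k)).1
  have h3 := (wBack_bounds (⨆ k, f k)).1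
  have h4 : 0 ≤ wTop (⨆ k, f k) := le_max_left _ _
  have hf0 := hf.nonneg
  cases n with
  | zero => have := hf0 0; have := hf0 1; rw [mix]; positivity
  | succ n =>
    have := hf0 n; have := hf0 (n + 1); have := hf0 (n + 2); rw [mix]; positivity

theorem mix_le {f : ℕ → ℝ} (hf : IsFan f) (n : ℕ) : mix f n ≤ 12 := by
  have ht0 := hf.iSup_nonneg
  have ht12 := hf.iSup_le
  have hle := hf.le_iSup
  have h1 := wFwd_bounds (⨆ k, f k)
  have h2 := wStay_bounds (⨆ k, f k)
  have h3 := wBack_bounds (⨆ k, f k)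
  have hm : ∀ {w : ℝ} n, 0 ≤ w → w * f n ≤ w * ⨆ k, f k := fun n hw =>
    mul_le_mul_of_nonneg_left (hle n) hw
  set t := ⨆ k, f k with ht
  rcases le_total t 2 with h | h
  · obtain ⟨ha, hb, hc⟩ := weights_of_le_two h
    have hd : wTop t ≤ 1 := max_le zero_le_one (by linarith)
    cases n with
    | zero => rw [mix, ← ht, hb, hc]; linarith [hle 0, hle 1]
    | succ n => rw [mix, ← ht, ha, hb, hc]; linarith [hle (n + 2)]
  rcases le_total t 3 with h' | h'
  · obtain ⟨ha, hb, hd⟩ := weights_of_mem_two_three h h'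
    cases n with
    | zero =>
      have := hm 1 h3.1
      have : wBack t * t ≤ 2 * t := mul_le_mul_of_nonneg_right h3.2 ht0
      rw [mix, ← ht, hb, hd]; linarith [hle 0]
    | succ n =>
      have := hm (n + 1) h2.1
      have := hm (n + 2) h3.1
      rw [mix, ← ht, ha]
      have : wStay t * t + wBack t * t = 2 * t := by rw [hb]; ring
      linarith
  · obtain ⟨hb, hc, hd⟩ := weights_of_three_le h'
    have hkey : wFwd t * t + wStay t * t ≤ 12 := by
      rcases le_total t 4 with h4 | h4
      · rw [hb]; nlinarith
      · have : wFwd t = 1 := by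
          rw [wFwd, min_eq_left (by linarith), max_eq_right (by linarith)]
        rw [hb, this]; linarith
    cases n with
    | zero =>
      have := hm 0 h2.1
      have : 0 ≤ wFwd t * t := mul_nonneg h1.1 ht0
      rw [mix, ← ht, hc, hd]; linarith
    | succ n =>
      have := hm n h1.1
      have := hm (n + 1) h2.1
      rw [mix, ← ht, hc]; linarith

/-- The self-map `focus ∘ mix` of the fan. -/
noncomputable def push (f : ℕ → ℝ) : ℕ → ℝ := focus (mix f)

theorem isFan_push {f : ℕ → ℝ} (hf : IsFan f) : IsFan (push f) := isFan_focus (mix_le hf)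

theorem abs_push_sub_push_le {f g : ℕ → ℝ} (hf : IsFan f) (hg : IsFan g) {δ : ℝ}
    (h : ∀ n, |f n - g n| ≤ δ) (n : ℕ) : |push f n - push g n| ≤ 200 * δ := by
  have hδ : 0 ≤ δ := (abs_nonneg _).trans (h 0)
  have := abs_focus_sub_focus_le (mix_le hf) (mix_le hg) (by positivity)
    (abs_mix_sub_mix_le hf hg h) n
  rw [push, push]
  linarith

theorem push_le_mix {f : ℕ → ℝ} (hf : IsFan f) (n : ℕ) : push f n ≤ mix f n :=
  max_le (mix_nonneg hf n) (by linarith [farSup_nonneg (mix_le hf) n])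

/-- Of three consecutive indices only the outer two are far apart, and these compete. -/
theorem focus_of_support_triple {h : ℕ → ℝ} (h0 : ∀ n, 0 ≤ h n) (hle : ∀ n, h n ≤ 12) {N : ℕ}
    (hs : ∀ m, m ≠ N → m ≠ N + 1 → m ≠ N + 2 → h m = 0) :
    focus h N = max 0 (h N - h (N + 2)) ∧ focus h (N + 1) = h (N + 1) ∧
      focus h (N + 2) = max 0 (h (N + 2) - h N) := by
  have h1 : farSup h N = h (N + 2) := by
    refine le_antisymm (farSup_le (h0 _) fun m hm => ?_) (le_farSup hle (by omega))
    by_cases hm2 : m = N + 2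
    · rw [hm2]
    · rw [hs m (by omega) (by omega) hm2]; exact h0 _
  have h2 : farSup h (N + 1) = 0 := by
    refine le_antisymm (farSup_le le_rfl fun m hm => ?_) (farSup_nonneg hle _)
    exact (hs m (by omega) (by omega) (by omega)).le
  have h3 : farSup h (N + 2) = h N := by
    refine le_antisymm (farSup_le (h0 _) fun m hm => ?_) (le_farSup hle (by omega))
    by_cases hm2 : m = N
    · rw [hm2]
    · rw [hs m hm2 (by omega) (by omega)]; exact h0 _
  refine ⟨by rw [focus, h1], ?_, by rw [focus, h3]⟩
  rw [focus, h2, sub_zero, max_eq_right (h0 _)]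

/-- The linear map with matrix `[[u, -v], [v, u]]` expands by a definite factor when
`u ^ 2 + v ^ 2 ≥ 1 / 5`. -/
theorem le_of_rotation_small {u v p q η : ℝ} (hu : |u| ≤ 2) (hv : |v| ≤ 2)
    (huv : 1 / 5 ≤ u ^ 2 + v ^ 2) (h1 : |u * p - v * q| ≤ η)
    (h2 : |v * p + u * q| ≤ η) : p ≤ 20 * η ∧ q ≤ 20 * η := by
  have hη : 0 ≤ η := (abs_nonneg _).trans h1
  have key : ∀ {w z : ℝ}, |w| ≤ 2 → |z| ≤ η → |w * z| ≤ 2 * η := fun {w z} hw hz => by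
    rw [abs_mul]
    exact mul_le_mul hw hz (abs_nonneg _) zero_le_two
  have a1 := abs_le.1 (key hu h1)
  have a2 := abs_le.1 (key hv h2)
  have a3 := abs_le.1 (key hv h1)
  have a4 := abs_le.1 (key hu h2)
  constructor <;> by_contra! hc <;> nlinarith

/-- At height at most `2`, `mix` is twice the backward shift plus a multiple of the first unit
vector. -/
theorem exists_lt_of_iSup_le_two {f : ℕ → ℝ} (hf : IsFan f) (ht : ⨆ k, f k ≤ 2) :
    ∃ n, 1 / 100 < |push f n - f n| := by
  by_contra! hcon
  obtain ⟨ha, hb, hc⟩ := weights_of_le_two ht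
  have hd : 1 - (⨆ k, f k) ≤ wTop (⨆ k, f k) := le_max_right _ _
  have hd0 : 0 ≤ wTop (⨆ k, f k) := le_max_left _ _
  have hmix : ∀ m, mix f (m + 1) = 2 * f (m + 2) := fun m => by rw [mix, ha, hb, hc]; ring
  have hmix0 : mix f 0 = 2 * f 0 + 2 * f 1 + wTop (⨆ k, f k) := by rw [mix, hb, hc]; ring
  have hup : ∀ n, f n ≤ push f n + 1 / 100 := fun n => by linarith [(abs_le.1 (hcon n)).1]
  have hdn : ∀ n, push f n ≤ f n + 1 / 100 := fun n => by linarith [(abs_le.1 (hcon n)).2]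
  have hpm := push_le_mix hf
  obtain ⟨N, hN⟩ := hf.exists_support
  have hsup := hf.iSup_eq hN
  have hfar : farSup (mix f) 0 ≤ 2 * ⨆ k, f k := by
    refine farSup_le (by linarith [hf.iSup_nonneg]) fun m hm => ?_
    obtain ⟨m, rfl⟩ : ∃ j, m = j + 1 := ⟨m - 1, by omega⟩
    rw [hmix]
    linarith [hf.le_iSup (m + 2)]
  have hp0 : mix f 0 - 2 * (⨆ k, f k) ≤ push f 0 :=
    le_trans (by linarith) (le_max_right 0 (mix f 0 - farSup (mix f) 0))
  have hq : f (N + 1) ≤ 1 / 100 := by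
    have h1 := hup (N + 1)
    have h2 := hpm (N + 1)
    rw [hmix, hN (N + 2) (by omega) (by omega)] at h2
    linarith
  cases N with
  | zero =>
    have h1 : farSup (mix f) 0 ≤ 0 := farSup_le le_rfl fun m hm => by
      obtain ⟨m, rfl⟩ : ∃ j, m = j + 1 := ⟨m - 1, by omega⟩
      rw [hmix, hN (m + 2) (by omega) (by omega), mul_zero]
    have h2 : mix f 0 ≤ push f 0 :=
      le_trans (by linarith) (le_max_right 0 (mix f 0 - farSup (mix f) 0))
    have h3 := hdn 0
    have h4 := hf.nonneg 1
    have h5 : f 0 ≤ 1 / 100 := by linarith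
    have h6 : ⨆ k, f k ≤ 1 / 100 := by rw [hsup]; exact max_le h5 hq
    linarith [hf.nonneg 0]
  | succ N =>
    have h1 := hup (N + 1)
    have h2 := hpm (N + 1)
    rw [hmix] at h2
    have h5 : f (N + 1) ≤ 3 / 100 := by linarith
    have h6 : ⨆ k, f k ≤ 3 / 100 := by rw [hsup]; exact max_le h5 (by linarith)
    have h7 := hdn 0
    have h8 := hf.le_iSup 0
    have h9 := hf.nonneg 0
    have h10 := hf.nonneg 1
    linarith

/-- At height between `2` and `3`, `mix` combines the identity and the backward shift. -/
theorem exists_lt_of_iSup_mem_two_three {f : ℕ → ℝ} (hf : IsFan f) (h2 : 2 ≤ ⨆ k, f k)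
    (h3 : ⨆ k, f k ≤ 3) : ∃ n, 1 / 100 < |push f n - f n| := by
  by_contra! hcon
  obtain ⟨ha, hb, hd⟩ := weights_of_mem_two_three h2 h3
  have hc := wBack_bounds (⨆ k, f k)
  obtain ⟨N, hN⟩ := hf.exists_support
  have hsup := hf.iSup_eq hN
  rw [hsup] at h2
  set c := wBack (⨆ k, f k) with hcdef
  have hmix : ∀ m, mix f (m + 1) = (2 - c) * f (m + 1) + c * f (m + 2) := fun m => by
    rw [mix, ha, hb, ← hcdef]; ring
  have hmix0 : mix f 0 = 2 * f 0 + c * f 1 := by rw [mix, hb, hd, ← hcdef]; ring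
  cases N with
  | zero =>
    obtain ⟨e0, e1, -⟩ := focus_of_support_triple (mix_nonneg hf) (mix_le hf) (N := 0)
      fun m h0 h1 _ => by
        obtain ⟨m, rfl⟩ : ∃ j, m = j + 1 := ⟨m - 1, by omega⟩
        rw [hmix, hN (m + 1) (by omega) (by omega), hN (m + 2) (by omega) (by omega)]; ring
    have m2 : mix f 2 = 0 := by
      rw [hmix 1, hN 2 (by omega) (by omega), hN 3 (by omega) (by omega)]; ring
    have m1 : mix f 1 = (2 - c) * f 1 := by rw [hmix 0, hN 2 (by omega) (by omega)]; ring
    have k0 := (abs_le.1 (hcon 0)).2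
    have k1 := (abs_le.1 (hcon 1)).2
    rw [push, e0, zero_add, m2, hmix0] at k0
    rw [push, e1, zero_add, m1] at k1
    have := le_max_right 0 (2 * f 0 + c * f 1 - 0)
    have hp := hf.nonneg 0
    have hq := hf.nonneg 1
    have hcq := mul_nonneg hc.1 hq
    have : 2 ≤ f 1 := (le_max_iff.1 h2).resolve_left (by linarith)
    linarith
  | succ N =>
    have hfN : f N = 0 := hN N (by omega) (by omega)
    have m0 : mix f N = c * f (N + 1) := by
      cases N with
      | zero => rw [hmix0, hfN]; ring
      | succ N => rw [hmix, hfN]; ring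
    have m1 := hmix N
    have m2 : mix f (N + 2) = (2 - c) * f (N + 2) := by
      rw [hmix, hN (N + 1 + 2) (by omega) (by omega)]; ring
    obtain ⟨e0, e1, e2⟩ := focus_of_support_triple (mix_nonneg hf) (mix_le hf) (N := N)
      fun m h0 h1 h2 => by
        cases m with
        | zero => rw [hmix0, hN 0 (by omega) (by omega), hN 1 (by omega) (by omega)]; ring
        | succ m =>
          rw [hmix, hN (m + 1) (by omega) (by omega), hN (m + 2) (by omega) (by omega)]; ring
    have k0 := hcon N
    have k1 := hcon (N + 1)
    have k2 := hcon (N + 2)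
    rw [push, e0, m0, m2, hfN, sub_zero] at k0
    rw [push, e1, m1] at k1
    rw [push, e2, m0, m2] at k2
    have hp := hf.nonneg (N + 1)
    have hq := hf.nonneg (N + 2)
    rw [show N + 1 + 1 = N + 2 from rfl] at h2
    set p := f (N + 1)
    set q := f (N + 2)
    have k0' : c * p - (2 - c) * q ≤ 1 / 100 :=
      (le_max_right 0 _).trans ((le_abs_self _).trans k0)
    have k1' : |c * q + (1 - c) * p| ≤ 1 / 100 := by
      rwa [show c * q + (1 - c) * p = (2 - c) * p + c * q - p by ring]
    rcases le_total ((2 - c) * q) (c * p) with h | h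
    · rw [max_eq_left (by linarith), zero_sub, abs_neg, abs_of_nonneg hq] at k2
      have hp2 : 2 ≤ p := (le_max_iff.1 h2).resolve_right (by linarith)
      have := (abs_le.1 k1').2
      have : (2 - c) * q ≤ 2 * q := mul_le_mul_of_nonneg_right (by linarith) hq
      have := mul_nonneg hc.1 hq
      linarith
    · rw [max_eq_right (by linarith)] at k2
      -- Both coordinates of the displacement are small, and they form a scaled rotation of `(q, p)`.
      have k2' : |(1 - c) * q - c * p| ≤ 1 / 100 := by
        rwa [show (1 - c) * q - c * p = (2 - c) * q - c * p - q by ring]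
      obtain ⟨r1, r2⟩ := le_of_rotation_small (abs_le.2 ⟨by linarith, by linarith⟩)
        (abs_le.2 ⟨by linarith, by linarith⟩) (by nlinarith [sq_nonneg (2 * c - 1)]) k2' k1'
      rcases le_max_iff.1 h2 with h | h <;> linarith

/-- At height at least `3`, `mix` combines the forward shift and the identity. -/
theorem exists_lt_of_three_le_iSup {f : ℕ → ℝ} (hf : IsFan f) (h3 : 3 ≤ ⨆ k, f k) :
    ∃ n, 1 / 100 < |push f n - f n| := by
  by_contra! hcon
  obtain ⟨hb, hc, hd⟩ := weights_of_three_le h3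
  have ha := wFwd_bounds (⨆ k, f k)
  obtain ⟨N, hN⟩ := hf.exists_support
  have hsup := hf.iSup_eq hN
  rw [hsup] at h3
  set a := wFwd (⨆ k, f k) with hadef
  have hmix : ∀ m, mix f (m + 1) = a * f m + (2 - 2 * a) * f (m + 1) := fun m => by
    rw [mix, hb, hc, ← hadef]; ring
  have hmix0 : mix f 0 = (2 - 2 * a) * f 0 := by rw [mix, hb, hc, hd]; ring
  have m0 : mix f N = (2 - 2 * a) * f N := by
    cases N with
    | zero => exact hmix0
    | succ N => rw [hmix, hN N (by omega) (by omega)]; ring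
  have m1 := hmix N
  have m2 : mix f (N + 2) = a * f (N + 1) := by
    rw [hmix, hN (N + 1 + 1) (by omega) (by omega)]; ring
  obtain ⟨e0, e1, e2⟩ := focus_of_support_triple (mix_nonneg hf) (mix_le hf) (N := N)
    fun m h0 h1 h2 => by
      cases m with
      | zero => rw [hmix0, hN 0 (by omega) (by omega)]; ring
      | succ m =>
        rw [hmix, hN (m + 1) (by omega) (by omega), hN m (by omega) (by omega)]; ring
  have k0 := hcon N
  have k1 := hcon (N + 1)
  have k2 := hcon (N + 2)
  rw [push, e0, m0, m2] at k0
  rw [push, e1, m1] at k1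
  rw [push, e2, m0, m2, hN (N + 2) (by omega) (by omega), sub_zero] at k2
  have hp := hf.nonneg N
  have hq := hf.nonneg (N + 1)
  set p := f N
  set q := f (N + 1)
  have k2' : a * q - (2 - 2 * a) * p ≤ 1 / 100 :=
    (le_max_right 0 _).trans ((le_abs_self _).trans k2)
  have k1' : |a * p + (1 - 2 * a) * q| ≤ 1 / 100 := by
    rwa [show a * p + (1 - 2 * a) * q = a * p + (2 - 2 * a) * q - q by ring]
  rcases le_total ((2 - 2 * a) * p) (a * q) with h | h
  · rw [max_eq_left (by linarith), zero_sub, abs_neg, abs_of_nonneg hp] at k0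
    have hq3 : 3 ≤ q := (le_max_iff.1 h3).resolve_left (by linarith)
    have := (abs_le.1 k1').2
    have : (2 - 2 * a) * p ≤ 2 * p := mul_le_mul_of_nonneg_right (by linarith) hp
    have := mul_nonneg ha.1 hp
    linarith
  · rw [max_eq_right (by linarith)] at k0
    -- Both coordinates of the displacement are small, and they form a scaled rotation of `(p, q)`.
    have k0' : |(1 - 2 * a) * p - a * q| ≤ 1 / 100 := by
      rwa [show (1 - 2 * a) * p - a * q = (2 - 2 * a) * p - a * q - p by ring]
    obtain ⟨r1, r2⟩ := le_of_rotation_small (abs_le.2 ⟨by linarith, by linarith⟩)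
      (abs_le.2 ⟨by linarith, by linarith⟩) (by nlinarith [sq_nonneg (5 * a - 2)]) k0' k1'
    rcases le_max_iff.1 h3 with h | h <;> linarith

theorem exists_lt_abs_push_sub {f : ℕ → ℝ} (hf : IsFan f) : ∃ n, 1 / 100 < |push f n - f n| := by
  rcases le_total (⨆ k, f k) 2 with h | h
  · exact exists_lt_of_iSup_le_two hf h
  rcases le_total (⨆ k, f k) 3 with h' | h'
  · exact exists_lt_of_iSup_mem_two_three hf h h'
  · exact exists_lt_of_three_le_iSup hf h'

/-! ### Uniformly independent sequences in noncompact sets -/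

section Banach

variable {X : Type*} [NormedAddCommGroup X] [NormedSpace ℝ X]

/-- With `e` independent of the subspace, some point of `C` has distance at least `e` from `z + F`. -/
theorem exists_forall_le_norm_sub_of_not_totallyBounded {C : Set X} (hbdd : Bornology.IsBounded C)
    (hC : ¬ TotallyBounded C) (z : X) :
    ∃ e > 0, ∀ F : Submodule ℝ X, FiniteDimensional ℝ F →
      ∃ v, z + v ∈ C ∧ ∀ w ∈ F, e ≤ ‖v - w‖ := by
  rw [Metric.totallyBounded_iff] at hC
  push Not at hC
  obtain ⟨ε, hε, hC⟩ := hC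
  refine ⟨ε / 2, half_pos hε, fun F hF => ?_⟩
  by_contra! hcon
  obtain ⟨R, hR⟩ := hbdd.subset_closedBall z
  -- A bounded part of `F` is precompact, and a finite net of it would be a finite net of `C`.
  have hcomp : IsCompact ((↑) '' Metric.closedBall (0 : F) (R + ε) : Set X) :=
    (isCompact_closedBall (0 : F) (R + ε)).image continuous_subtype_val
  obtain ⟨t, ht, hcov⟩ := Metric.totallyBounded_iff.1 hcomp.totallyBounded (ε / 2) (half_pos hε)
  refine hC ((fun w => z + w) '' t) (ht.image _) fun x hx => ?_
  obtain ⟨w, hwF, hw⟩ := hcon (x - z) (by simpa using hx)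
  have hxz : ‖x - z‖ ≤ R := by simpa [dist_eq_norm] using hR hx
  have hwR : ‖w‖ ≤ R + ε := by
    have := norm_sub_norm_le w (x - z)
    rw [norm_sub_rev w] at this
    linarith
  have hwt := hcov ⟨⟨w, hwF⟩, by simpa using hwR, rfl⟩
  simp only [Set.mem_iUnion, Metric.mem_ball, dist_eq_norm] at hwt
  obtain ⟨v, hv, hwv⟩ := hwt
  simp only [Set.mem_iUnion, Metric.mem_ball, dist_eq_norm]
  refine ⟨z + v, ⟨v, hv, rfl⟩, ?_⟩
  calc ‖x - (z + v)‖ = ‖(x - z - w) + (w - v)‖ := by congr 1; abel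
    _ ≤ ‖x - z - w‖ + ‖w - v‖ := norm_add_le _ _
    _ < ε := by linarith

theorem exists_seq_of_not_totallyBounded {C : Set X} (hbdd : Bornology.IsBounded C)
    (hC : ¬ TotallyBounded C) (z : X) :
    ∃ e > 0, ∃ y : ℕ → X, (∀ n, z + y n ∈ C) ∧
      ∀ n, ∀ w ∈ Submodule.span ℝ (y '' Set.Iio n), e ≤ ‖y n - w‖ := by
  classical
  obtain ⟨e, he, h⟩ := exists_forall_le_norm_sub_of_not_totallyBounded hbdd hC z
  have h' : ∀ s : Finset X, ∃ v, z + v ∈ C ∧ ∀ w ∈ Submodule.span ℝ (s : Set X), e ≤ ‖v - w‖ :=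
    fun s => h _ inferInstance
  choose v hvC hv using h'
  let s : ℕ → Finset X := fun n => Nat.rec ∅ (fun _ t => insert (v t) t) n
  have hs : ∀ n, s (n + 1) = insert (v (s n)) (s n) := fun _ => rfl
  have hmono : Monotone s := monotone_nat_of_le_succ fun n => by
    rw [hs]; exact Finset.subset_insert _ _
  refine ⟨e, he, fun n => v (s n), fun n => hvC _, fun n w hw => hv _ w ?_⟩
  refine Submodule.span_mono ?_ hw
  rintro _ ⟨m, hm, rfl⟩
  have : v (s m) ∈ s (m + 1) := by rw [hs]; exact Finset.mem_insert_self _ _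
  exact hmono (Nat.succ_le_of_lt hm) this

/-- A linear combination of at most `k` terms of the sequence controls its coefficients. The
constant depends on `k`: the coefficient of the term of largest index is bounded first, and that
term is then removed. -/
theorem exists_abs_coord_le {y : ℕ → X} {e D : ℝ} (he : 0 < e)
    (hy : ∀ n, ∀ w ∈ Submodule.span ℝ (y '' Set.Iio n), e ≤ ‖y n - w‖)
    (hD : ∀ n, ‖y n‖ ≤ D) (k : ℕ) :
    ∃ A : ℝ, 0 ≤ A ∧ ∀ s : Finset ℕ, s.card ≤ k → ∀ v : ℕ → ℝ, ∀ i ∈ s,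
      |v i| ≤ A * ‖∑ j ∈ s, v j • y j‖ := by
  induction k with
  | zero =>
    refine ⟨0, le_rfl, fun s hs v i hi => ?_⟩
    rw [Finset.card_eq_zero.1 (Nat.le_zero.1 hs)] at hi
    simp at hi
  | succ k ih =>
    obtain ⟨A, hA, ih⟩ := ih
    have hD0 : 0 ≤ D := (norm_nonneg _).trans (hD 0)
    refine ⟨max (1 / e) (A * (1 + D / e)), le_max_of_le_left (by positivity),
      fun s hs v i hi => ?_⟩
    have hne : s.Nonempty := ⟨i, hi⟩
    set j := s.max' hne with hj
    have hjs : j ∈ s := s.max'_mem hne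
    set S := ∑ l ∈ s, v l • y l with hS
    set S' := ∑ l ∈ s.erase j, v l • y l with hS'
    have hsum : S = v j • y j + S' := (Finset.add_sum_erase s _ hjs).symm
    have hspan : S' ∈ Submodule.span ℝ (y '' Set.Iio j) := by
      refine Submodule.sum_mem _ fun l hl => Submodule.smul_mem _ _ (Submodule.subset_span ?_)
      exact ⟨l, lt_of_le_of_ne (s.le_max' l (Finset.mem_of_mem_erase hl))
        (Finset.ne_of_mem_erase hl), rfl⟩
    have hvj : |v j| ≤ 1 / e * ‖S‖ := by
      rcases eq_or_ne (v j) 0 with h0 | h0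
      · rw [h0, abs_zero]; positivity
      have h1 := hy j (-((v j)⁻¹ • S')) (Submodule.neg_mem _ (Submodule.smul_mem _ _ hspan))
      have h2 : S = v j • (y j - -((v j)⁻¹ • S')) := by
        rw [sub_neg_eq_add, smul_add, smul_inv_smul₀ h0, hsum]
      have h3 : |v j| * e ≤ ‖S‖ := by
        rw [h2, norm_smul, Real.norm_eq_abs]
        exact mul_le_mul_of_nonneg_left h1 (abs_nonneg _)
      rw [one_div, inv_mul_eq_div, le_div_iff₀ he]
      exact h3
    rcases eq_or_ne i j with hij | hij
    · rw [hij]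
      exact hvj.trans (mul_le_mul_of_nonneg_right (le_max_left _ _) (norm_nonneg _))
    · have h1 := ih (s.erase j) (by rw [Finset.card_erase_of_mem hjs]; omega) v i
        (Finset.mem_erase.2 ⟨hij, hi⟩)
      have h2 : ‖S'‖ ≤ (1 + D / e) * ‖S‖ := by
        have h3 : S' = S - v j • y j := by rw [hsum]; abel
        calc ‖S'‖ ≤ ‖S‖ + ‖v j • y j‖ := by rw [h3]; exact norm_sub_le _ _
          _ ≤ ‖S‖ + 1 / e * ‖S‖ * D := by
            rw [norm_smul, Real.norm_eq_abs]
            gcongr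
            exact hD j
          _ = (1 + D / e) * ‖S‖ := by ring
      calc |v i| ≤ A * ‖S'‖ := h1
        _ ≤ A * ((1 + D / e) * ‖S‖) := mul_le_mul_of_nonneg_left h2 hA
        _ = A * (1 + D / e) * ‖S‖ := by ring
        _ ≤ _ := mul_le_mul_of_nonneg_right (le_max_right _ _) (norm_nonneg _)

/-! ### The fan inside a convex set -/

/-- The point of `X` with coordinates `p` in the system `y` based at `z`. The factor `1 / 24` makes
the images of fan elements convex combinations of `z` and the points `z + yₙ`. -/
noncomputable def realize (z : X) (y : ℕ → X) (p : ℕ → ℝ) : X := z + (1 / 24 : ℝ) • ∑' n, p n • y n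

theorem realize_mem {C : Set X} (hconv : Convex ℝ C) {z : X} (hz : z ∈ C) {y : ℕ → X}
    (hy : ∀ n, z + y n ∈ C) {p : ℕ → ℝ} (hp : IsFan p) : realize z y p ∈ C := by
  obtain ⟨N, hN⟩ := hp.exists_support
  have hsum : ∑' n, p n • y n = p N • y N + p (N + 1) • y (N + 1) := by
    rw [tsum_eq_sum (s := {N, N + 1}) fun m hm => ?_, Finset.sum_pair (by omega)]
    simp only [Finset.mem_insert, Finset.mem_singleton, not_or] at hm
    rw [hN m hm.1 hm.2, zero_smul]
  have h0 := hp.nonneg N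
  have h1 := hp.nonneg (N + 1)
  have h2 := hp.le N
  have h3 := hp.le (N + 1)
  have := hconv.sum_mem (t := Finset.univ)
    (w := ![1 - p N / 24 - p (N + 1) / 24, p N / 24, p (N + 1) / 24])
    (z := ![z, z + y N, z + y (N + 1)])
    (by intro i _; fin_cases i <;> simp <;> linarith)
    (by simp [Fin.sum_univ_three]; ring)
    (by intro i _; fin_cases i <;> simp [hz, hy])
  convert this using 1
  simp only [realize, hsum, Fin.sum_univ_three, Matrix.cons_val_zero, Matrix.cons_val_one,
    Matrix.cons_val]
  module

theorem exists_realize_sub_realize_eq (z : X) (y : ℕ → X) {p q : ℕ → ℝ} (hp : IsFan p)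
    (hq : IsFan q) : ∃ s : Finset ℕ, s.card ≤ 4 ∧ (∀ n, n ∉ s → p n = 0 ∧ q n = 0) ∧
      realize z y p - realize z y q = (1 / 24 : ℝ) • ∑ n ∈ s, (p n - q n) • y n := by
  classical
  obtain ⟨N, hN⟩ := hp.exists_support
  obtain ⟨M, hM⟩ := hq.exists_support
  have hz : ∀ n, n ∉ ({N, N + 1, M, M + 1} : Finset ℕ) → p n = 0 ∧ q n = 0 := fun n hn => by
    simp only [Finset.mem_insert, Finset.mem_singleton, not_or] at hn
    exact ⟨hN n hn.1 hn.2.1, hM n hn.2.2.1 hn.2.2.2⟩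
  refine ⟨{N, N + 1, M, M + 1}, Finset.card_le_four, hz, ?_⟩
  rw [realize, realize, tsum_eq_sum fun n hn => by rw [(hz n hn).1, zero_smul],
    tsum_eq_sum fun n hn => by rw [(hz n hn).2, zero_smul]]
  simp only [sub_smul, Finset.sum_sub_distrib]
  module

theorem norm_realize_sub_realize_le (z : X) {y : ℕ → X} {D : ℝ} (hD : ∀ n, ‖y n‖ ≤ D)
    {p q : ℕ → ℝ} (hp : IsFan p) (hq : IsFan q) {δ : ℝ} (h : ∀ n, |p n - q n| ≤ δ) :
    ‖realize z y p - realize z y q‖ ≤ D * δ := by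
  have hδ : 0 ≤ δ := (abs_nonneg _).trans (h 0)
  have hD0 : 0 ≤ D := (norm_nonneg _).trans (hD 0)
  obtain ⟨s, hs, -, heq⟩ := exists_realize_sub_realize_eq z y hp hq
  have h1 : ‖∑ n ∈ s, (p n - q n) • y n‖ ≤ s.card • (δ * D) := by
    rw [← Finset.sum_const]
    refine norm_sum_le_of_le s fun n _ => ?_
    rw [norm_smul, Real.norm_eq_abs]
    exact mul_le_mul (h n) (hD n) (norm_nonneg _) hδ
  have h2 : s.card • (δ * D) ≤ 4 * (δ * D) := by
    rw [nsmul_eq_mul]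
    exact mul_le_mul_of_nonneg_right (by exact_mod_cast hs) (by positivity)
  have h3 : 0 ≤ δ * D := by positivity
  rw [heq, norm_smul, Real.norm_of_nonneg (by norm_num)]
  linarith

/-- The coordinates on the realized fan extend to uniformly Lipschitz functions on the whole
space. -/
theorem exists_coord_extension (z : X) {y : ℕ → X} {A : ℝ}
    (hA : ∀ s : Finset ℕ, s.card ≤ 4 → ∀ v : ℕ → ℝ, ∀ i ∈ s, |v i| ≤ A * ‖∑ j ∈ s, v j • y j‖)
    (hA0 : 0 ≤ A) :
    ∃ ρ : X → ℕ → ℝ, (∀ x n, 0 ≤ ρ x n ∧ ρ x n ≤ 12) ∧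
      (∀ x x' n, |ρ x n - ρ x' n| ≤ 24 * A * ‖x - x'‖) ∧
      ∀ p, IsFan p → ρ (realize z y p) = p := by
  classical
  have hcoord : ∀ p q, IsFan p → IsFan q → ∀ n,
      |p n - q n| ≤ 24 * A * ‖realize z y p - realize z y q‖ := fun p q hp hq n => by
    obtain ⟨s, hs, hz, heq⟩ := exists_realize_sub_realize_eq z y hp hq
    by_cases hn : n ∈ s
    · have := hA s hs (fun n => p n - q n) n hn
      rw [heq, norm_smul, Real.norm_of_nonneg (by norm_num)]
      linarith
    · rw [(hz n hn).1, (hz n hn).2, sub_zero, abs_zero]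
      positivity
  let inv : X → ℕ → ℝ := Function.invFunOn (realize z y) {p | IsFan p}
  have hinv : ∀ x ∈ realize z y '' {p | IsFan p}, IsFan (inv x) ∧ realize z y (inv x) = x :=
    fun x hx => Function.invFunOn_pos hx
  have hlip : ∀ n, LipschitzOnWith (24 * A).toNNReal (fun x => inv x n)
      (realize z y '' {p | IsFan p}) := fun n => LipschitzOnWith.of_dist_le_mul fun x hx x' hx' => by
    have h := hcoord _ _ (hinv x hx).1 (hinv x' hx').1 n
    rw [(hinv x hx).2, (hinv x' hx').2] at h
    rwa [Real.coe_toNNReal _ (by positivity), Real.dist_eq, dist_eq_norm]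
  choose g hg hgeq using fun n => (hlip n).extend_real
  refine ⟨fun x n => max 0 (min 12 (g n x)), fun x n => ⟨le_max_left _ _,
    max_le (by norm_num) (min_le_left _ _)⟩, fun x x' n => ?_, fun p hp => ?_⟩
  · have h1 := (hg n).dist_le_mul x x'
    rw [Real.coe_toNNReal _ (by positivity), Real.dist_eq, dist_eq_norm] at h1
    refine (abs_max_sub_max_le_max 0 _ 0 _).trans (max_le (by simp; positivity) ?_)
    exact (abs_min_sub_min_le_max 12 _ 12 _).trans (max_le (by simp; positivity) h1)
  · have hmem : realize z y p ∈ realize z y '' {p | IsFan p} := ⟨p, hp, rfl⟩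
    obtain ⟨h1, h2⟩ := hinv _ hmem
    funext n
    have h3 : inv (realize z y p) n = p n := by
      have := hcoord _ _ h1 hp n
      rw [h2, sub_self, norm_zero, mul_zero] at this
      exact sub_eq_zero.1 (abs_nonpos_iff.1 this)
    simp only [← hgeq n hmem, h3, min_eq_right (hp.le n), max_eq_right (hp.nonneg n)]

/-- A bounded convex set that is not totally bounded admits a Lipschitz map into it without
approximate fixed points; the map is even defined on the whole space. -/
theorem exists_lipschitz_displacement {C : Set X} (hbdd : Bornology.IsBounded C)
    (hconv : Convex ℝ C) (hC : ¬ TotallyBounded C) :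
    ∃ (T : X → X) (Λ d : ℝ), 0 ≤ Λ ∧ 0 < d ∧ (∀ x x', ‖T x - T x'‖ ≤ Λ * ‖x - x'‖) ∧
      (∀ x, T x ∈ C) ∧ ∀ x, d ≤ ‖x - T x‖ := by
  obtain ⟨z, hz⟩ : C.Nonempty := by
    by_contra h
    rw [Set.not_nonempty_iff_eq_empty] at h
    exact hC (h ▸ totallyBounded_empty)
  obtain ⟨e, he, y, hyC, hy⟩ := exists_seq_of_not_totallyBounded hbdd hC z
  obtain ⟨D, hD⟩ : ∃ D, ∀ n, ‖y n‖ ≤ D := by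
    obtain ⟨R, hR⟩ := hbdd.subset_closedBall z
    exact ⟨R, fun n => by simpa using hR (hyC n)⟩
  have hD0 : 0 ≤ D := (norm_nonneg _).trans (hD 0)
  obtain ⟨A, hA0, hA⟩ := exists_abs_coord_le he hy hD 4
  obtain ⟨ρ, hρ, hρlip, hρinv⟩ := exists_coord_extension z hA hA0
  have hfan : ∀ x, IsFan (focus (ρ x)) := fun x => isFan_focus fun n => (hρ x n).2
  have hpush : ∀ x, IsFan (push (focus (ρ x))) := fun x => isFan_push (hfan x)
  refine ⟨fun x => realize z y (push (focus (ρ x))), D * (200 * (2 * (24 * A))),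
    1 / (4800 * (A + 1)), by positivity, by positivity, fun x x' => ?_,
    fun x => realize_mem hconv hz hyC (hpush x), fun x => ?_⟩
  · have h1 := abs_focus_sub_focus_le (fun n => (hρ x n).2) (fun n => (hρ x' n).2)
      (by positivity) (hρlip x x')
    have h2 := abs_push_sub_push_le (hfan x) (hfan x') h1
    refine (norm_realize_sub_realize_le z hD (hpush x) (hpush x') h2).trans (le_of_eq ?_)
    ring
  · -- If `x` is almost fixed, then so is the fan point `focus (ρ x)` under `push`.
    set r := ‖x - realize z y (push (focus (ρ x)))‖ with hr
    have hr0 : 0 ≤ r := norm_nonneg _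
    obtain ⟨n, hn⟩ := exists_lt_abs_push_sub (hfan x)
    have h1 := fun n => hρlip x (realize z y (push (focus (ρ x)))) n
    rw [hρinv _ (hpush x)] at h1
    have h2 := abs_focus_sub_focus_le (fun n => (hρ x n).2) (hpush x).le
      (by positivity) h1 n
    rw [(hpush x).focus_eq, abs_sub_comm, ← hr] at h2
    rw [div_le_iff₀ (by positivity)]
    nlinarith

end Banach

/-! ### Small homothetic copies -/

theorem InfiniteSlopeAtZero.exists_mul_le {ω : ℝ≥0 → ℝ≥0} (h : InfiniteSlopeAtZero ω) (Λ : ℝ) :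
    ∃ δ > (0 : ℝ), ∀ t : ℝ≥0, (t : ℝ) < δ → Λ * t ≤ ω t := by
  have h1 := h.eventually (eventually_ge_atTop Λ.toNNReal)
  obtain ⟨δ, hδ, hδ'⟩ := (mem_nhdsGT_iff_exists_Ioo_subset (a := (0 : ℝ≥0))).1 h1
  refine ⟨δ, by exact_mod_cast hδ, fun t ht => ?_⟩
  rcases eq_zero_or_pos t with h0 | h0
  · simp [h0]
  have h2 : Λ.toNNReal ≤ ω t / t := hδ' ⟨h0, by exact_mod_cast ht⟩
  rw [le_div_iff₀ h0] at h2
  calc Λ * t ≤ Λ.toNNReal * t := mul_le_mul_of_nonneg_right (Real.le_coe_toNNReal Λ) t.2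
    _ ≤ ω t := by exact_mod_cast h2

theorem mainTheorem5 {X : Type*} [NormedAddCommGroup X] [NormedSpace ℝ X] [CompleteSpace X]
    (C : Set X) (hbdd : Bornology.IsBounded C) (hclosed : IsClosed C) (hconv : Convex ℝ C)
    (hnoncompact : ¬ IsCompact C)
    (ω : ℝ≥0 → ℝ≥0) (hω : IsModulus ω) (hω2 : InfiniteSlopeAtZero ω)
    (ε : ℝ) (hε : 0 < ε) :
    ∃ K : Set X, K ⊆ C ∧ IsClosed K ∧ Convex ℝ K ∧
      (∃ x₀ ∈ C, ∃ η : ℝ, 0 < η ∧ η < 1 ∧ η < ε ∧ K = AffineMap.homothety x₀ η '' C) ∧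
      ∀ L : ℝ, 0 < L → L ≤ 1 →
        ¬ HasAFPP K {T : K → K | IsNonexpansiveWith L ω T} := by
  have htb : ¬ TotallyBounded C := fun h =>
    hnoncompact (isCompact_iff_totallyBounded_isComplete.2 ⟨h, hclosed.isComplete⟩)
  obtain ⟨T, Λ, d, hΛ, hd, hTlip, hTC, hTd⟩ := exists_lipschitz_displacement hbdd hconv htb
  obtain ⟨δ, hδ, hδω⟩ := hω2.exists_mul_le Λ
  have hz : T 0 ∈ C := hTC 0
  set z := T 0
  obtain ⟨R, hR0, hR⟩ := hbdd.subset_closedBall_lt 0 z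
  -- The copy has diameter at most `2 * η * R < δ`, where `ω` dominates multiplication by `Λ`.
  obtain ⟨η, hη0, hη⟩ := exists_between (show 0 < min (min 1 ε) (δ / (2 * R)) by positivity)
  obtain ⟨⟨hη1, hηε⟩, hηδ⟩ : (η < 1 ∧ η < ε) ∧ η < δ / (2 * R) := by simpa using hη
  rw [lt_div_iff₀ (by positivity)] at hηδ
  have hhom : ∀ x, AffineMap.homothety z η x = z + η • (x - z) := fun x => by
    simp [AffineMap.homothety_apply, add_comm]
  have hdist : ∀ x x', dist (AffineMap.homothety z η x) (AffineMap.homothety z η x')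
      = η * ‖x - x'‖ := fun x x' => by
    rw [hhom, hhom, dist_eq_norm, add_sub_add_left_eq_sub, ← smul_sub, sub_sub_sub_cancel_right,
      norm_smul, Real.norm_of_nonneg hη0.le]
  refine ⟨AffineMap.homothety z η '' C, ?_, ?_, ?_, ⟨z, hz, η, hη0, hη1, hηε, rfl⟩,
    fun L hL _ hA => ?_⟩
  · rintro _ ⟨x, hx, rfl⟩
    rw [hhom]
    exact hconv.add_smul_sub_mem hz hx ⟨hη0.le, hη1.le⟩
  · have : ⇑(AffineMap.homothety z η) = fun x => z + η • (x - z) := funext hhom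
    rw [this]
    have h2 : IsClosedMap fun x => z + η • (x - z) :=
      (Homeomorph.addLeft z).isClosedMap.comp ((Homeomorph.smulOfNeZero η hη0.ne').isClosedMap.comp
        (Homeomorph.subRight z).isClosedMap)
    exact h2 _ hclosed
  · exact hconv.affine_image _
  · -- The conjugate of `T` by the homothety; `S` inverts the homothety on the copy.
    have hS : ∀ k : AffineMap.homothety z η '' C, ∃ x ∈ C, AffineMap.homothety z η x = k :=
      fun k => k.2
    choose S hSC hS using hS
    let T' : AffineMap.homothety z η '' C → AffineMap.homothety z η '' C := fun k =>
      ⟨AffineMap.homothety z η (T (S k)), T (S k), hTC _, rfl⟩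
    have hdS : ∀ k k', dist k k' = η * ‖S k - S k'‖ := fun k k' => by
      rw [← hdist, hS, hS, Subtype.dist_eq]
    have hT' : IsNonexpansiveWith L ω T' := fun k k' => by
      have h1 : dist (T' k) (T' k') ≤ Λ * dist k k' := by
        rw [Subtype.dist_eq, hdist, hdS]
        calc η * ‖T (S k) - T (S k')‖ ≤ η * (Λ * ‖S k - S k'‖) :=
              mul_le_mul_of_nonneg_left (hTlip _ _) hη0.le
          _ = Λ * (η * ‖S k - S k'‖) := by ring
      have h2 : ((nndist k k' : ℝ≥0) : ℝ) < δ := by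
        have h3 : ‖S k - S k'‖ ≤ R + R := by
          rw [← dist_eq_norm]
          exact (dist_triangle_right _ _ z).trans (add_le_add (hR (hSC k)) (hR (hSC k')))
        rw [coe_nndist, hdS]
        nlinarith
      have h3 := hδω _ h2
      rw [coe_nndist] at h3
      have : 0 ≤ L * dist k k' := by positivity
      linarith
    have : Nonempty (AffineMap.homothety z η '' C) := ⟨⟨_, z, hz, rfl⟩⟩
    have h4 : η * d ≤ minimalDisplacement T' := le_ciInf fun k => by
      rw [Subtype.dist_eq, ← hS k, hdist]
      exact mul_le_mul_of_nonneg_left (hTd _) hη0.le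
    rw [hA T' hT'] at h4
    exact absurd h4 (not_le.2 (by positivity))
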